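/- Let $k$ be a local field of characteristic zero, i.e. $\mathbb R$ or $\mathbb C$ with the usual absolute value, or a non-archimedean locally compact, non-trivially valued field of characteristic zero. All topological $k$-vector spaces are locally convex. An (FN)-space is a nuclear Fréchet space over $k$ (complete, metrizable, locally convex, and nuclear: for every continuous seminorm $p$ there is a continuous seminorm $q\ge p$ such that the canonical map between the completions of $(V,q)$ and $(V,p)$ is nuclear; over a non-archimedean $k$ seminorms are required to satisfy the strong triangle inequality). A (DFN)-space is a space isomorphic to the strong dual of an (FN)-space. A topological vector space $V$ is an analytic Tate space if $V=L\oplus G$ topologically for some subspaces $L,G\subset V$ such that, with the induced topologies, $L$ is an (FN)-space and $G$ is a (DFN)-space; the subspaces $L$ (respectively $G$) which occur in such a decomposition are called the (FN)-lattices (respectively (DFN)-lattices) of $V$. **Corollary.** Let $V$ be an analytic Tate space. If $L$ is an (FN)-lattice and $G$ is a (DFN)-lattice in $V$ (not necessarily belonging to the same decomposition), then $L\cap G$ is finite dimensional and $L+G$ has finite codimension in $V$. -/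

import Mathlib

open Topology

noncomputable section

universe u v w

/-- A local field of characteristic zero, with its absolute value: either `ℝ` or `ℂ` with the usual
absolute value, or a non-archimedean locally compact field of characteristic zero. -/
class IsLocalFieldCharZero (k : Type u) [NontriviallyNormedField k] : Prop where
  charZero : CharZero k
  locallyCompact : LocallyCompactSpace k
  archimedean_or : (∃ e : k ≃+* ℝ, Isometry e) ∨ (∃ e : k ≃+* ℂ, Isometry e) ∨ IsUltrametricDist k

section Seminorms

variable {k : Type u} [NontriviallyNormedField k] {V : Type v} [AddCommGroup V] [Module k V]

/-- The seminorms used over `k`: over an archimedean field all seminorms, over a non-archimedean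
field those that satisfy the strong triangle inequality. -/
def Seminorm.IsAdmissible (p : Seminorm k V) : Prop :=
  IsUltrametricDist k → ∀ x y, p (x + y) ≤ max (p x) (p y)

/-- The vector space `V`, to be seen as a seminormed space through `p`. -/
def SeminormedBy (_p : Seminorm k V) : Type v := V

instance (p : Seminorm k V) : AddCommGroup (SeminormedBy p) := inferInstanceAs (AddCommGroup V)

instance (p : Seminorm k V) : Module k (SeminormedBy p) := inferInstanceAs (Module k V)

instance (p : Seminorm k V) : SeminormedAddCommGroup (SeminormedBy p) :=
  AddGroupSeminorm.toSeminormedAddCommGroup (E := SeminormedBy p) p.toAddGroupSeminorm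

theorem SeminormedBy.norm_def (p : Seminorm k V) (x : SeminormedBy p) :
    ‖x‖ = p (show V from x) := rfl

instance (p : Seminorm k V) : NormedSpace k (SeminormedBy p) where
  norm_smul_le a x := (map_smul_eq_mul p a (show V from x)).le

/-- The local Banach space of `V` at `p`: the Hausdorff completion of `(V, p)`. -/
abbrev LocalBanach (p : Seminorm k V) : Type v := UniformSpace.Completion (SeminormedBy p)

/-- For `p ≤ q`, the identity of `V` as a continuous linear map `(V, q) → (V, p)`. -/
def SeminormedBy.map {p q : Seminorm k V} (h : p ≤ q) : SeminormedBy q →L[k] SeminormedBy p :=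
  LinearMap.mkContinuous
    { toFun := fun x => x, map_add' := fun _ _ => rfl, map_smul' := fun _ _ => rfl } 1
    (fun x => by rw [one_mul]; exact h x)

/-- For `p ≤ q`, the canonical map `LocalBanach q → LocalBanach p`. -/
def LocalBanach.map {p q : Seminorm k V} (h : p ≤ q) : LocalBanach q →L[k] LocalBanach p :=
  (SeminormedBy.map h).completion

end Seminorms

/-- A nuclear map between Banach spaces over `k`: a map `x ↦ ∑ₙ lₙ(x) yₙ`, where the series
`∑ₙ lₙ ⊗ yₙ` converges absolutely or, over a non-archimedean field, has terms tending to zero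
(that is, the map is in the image of the completed projective tensor product `E* ⊗ F`). -/
def IsNuclearMap {k : Type u} [NontriviallyNormedField k] {E : Type v} [NormedAddCommGroup E]
    [NormedSpace k E] {F : Type w} [NormedAddCommGroup F] [NormedSpace k F] (f : E →L[k] F) :
    Prop :=
  ∃ (l : ℕ → E →L[k] k) (y : ℕ → F),
    (Summable (fun n => ‖l n‖ * ‖y n‖) ∨
      (IsUltrametricDist k ∧ Filter.Tendsto (fun n => ‖l n‖ * ‖y n‖) Filter.atTop (𝓝 0))) ∧
    ∀ x, HasSum (fun n => l n x • y n) (f x)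

section Spaces

variable (k : Type u) [NontriviallyNormedField k] (V : Type v) [AddCommGroup V] [Module k V]
  [TopologicalSpace V]

/-- A locally convex topological vector space over `k`. -/
structure IsLocallyConvexTVS : Prop where
  isTopologicalAddGroup : IsTopologicalAddGroup V
  continuousSMul : ContinuousSMul k V
  exists_seminorm : ∀ U ∈ 𝓝 (0 : V),
    ∃ p : Seminorm k V, p.IsAdmissible ∧ Continuous p ∧ {x | p x < 1} ⊆ U

/-- Nuclearity: every continuous seminorm `p` is dominated by a continuous seminorm `q` such that
the canonical map of local Banach spaces is nuclear. -/
def IsNuclearTVS : Prop :=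
  ∀ p : Seminorm k V, p.IsAdmissible → Continuous p →
    ∃ q : Seminorm k V, q.IsAdmissible ∧ Continuous q ∧
      ∃ h : p ≤ q, IsNuclearMap (LocalBanach.map h)

/-- A Fréchet space: a locally convex space that is metrizable and complete. -/
structure IsFrechetTVS : Prop extends IsLocallyConvexTVS k V where
  metrizable : TopologicalSpace.MetrizableSpace V
  complete : @CompleteSpace V (IsTopologicalAddGroup.rightUniformSpace V)

/-- An (FN)-space: a nuclear Fréchet space. -/
structure IsFNSpace : Prop extends IsFrechetTVS k V where
  nuclear : IsNuclearTVS k V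

/-- A (DFN)-space: a space isomorphic to the strong dual of an (FN)-space `F`; Mathlib's topology
on `F →L[k] k` is that of uniform convergence on bounded sets. The universe of `F` is no
restriction: `F` is reflexive, hence isomorphic to the strong dual of `V`, which lives there. -/
def IsDFNSpace : Prop :=
  ∃ (F : Type (max u v)) (_ : AddCommGroup F) (_ : Module k F) (_ : TopologicalSpace F),
    IsFNSpace k F ∧ Nonempty (V ≃L[k] (F →L[k] k))

/-- An analytic Tate space: a locally convex space that is the topological direct sum of an
(FN)-subspace and a (DFN)-subspace. -/
def IsAnalyticTateSpace : Prop :=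
  IsLocallyConvexTVS k V ∧
    ∃ L G : Submodule k V, IsFNSpace k L ∧ IsDFNSpace k G ∧ Submodule.IsTopCompl L G

variable {k V}

/-- An (FN)-lattice: the (FN)-summand in a decomposition of `V` as a topological direct sum of an
(FN)-subspace and a (DFN)-subspace. -/
def IsFNLattice (L : Submodule k V) : Prop :=
  IsFNSpace k L ∧ ∃ G : Submodule k V, IsDFNSpace k G ∧ Submodule.IsTopCompl L G

/-- A (DFN)-lattice: the (DFN)-summand in such a decomposition. -/
def IsDFNLattice (G : Submodule k V) : Prop :=
  IsDFNSpace k G ∧ ∃ L : Submodule k V, IsFNSpace k L ∧ Submodule.IsTopCompl L G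

end Spaces

end

/-! Write V = L ⊕ G' = L' ⊕ G. Projecting L to G along L' and back to L along G' gives an
endomorphism K of L that fixes L ∩ G, so L ∩ G embeds in ker(1 - K). For the analogous K on L'
through G', the map 1 - K sends L' into L + G, and L' surjects onto V/(L + G), which is thus a
quotient of coker(1 - K). Both K factor through a (DFN)-space. By Baire, a map from a Fréchet space
to such a space is bounded near zero (`IsFrechetTVS.exists_nhds_isVonNBounded_image`), so K factors
as J ∘ ι through a local Banach space. By nuclearity ι ∘ J is within distance less than one of a
finite rank operator, so Riesz theory applies to it. The results pass back to K = J ∘ ι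
(`IsFNSpace.finiteDimensional_ker_and_coker`). -/

/-- If `V` is the sum of the range of `f` and the range of a linear map of finite rank, then the
range of `f` has finite codimension. -/
theorem LinearMap.finiteDimensional_quotient_range_of_le {k V W U : Type*} [Field k]
    [AddCommGroup V] [Module k V] [AddCommGroup W] [Module k W] [AddCommGroup U] [Module k U]
    (f : W →ₗ[k] V) (g : U →ₗ[k] V) [FiniteDimensional k g.range]
    (h : ∀ y, ∃ x u, y = f x + g u) : FiniteDimensional k (V ⧸ f.range) := by
  refine Module.Finite.of_surjective (f.range.mkQ ∘ₗ g.range.subtype) fun z => ?_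
  obtain ⟨y, rfl⟩ := f.range.mkQ_surjective z
  obtain ⟨x, u, rfl⟩ := h y
  refine ⟨⟨g u, u, rfl⟩, ?_⟩
  have : f.range.mkQ (f x) = 0 := by simp
  rw [map_add, this, zero_add]
  rfl

/-! ### Finite rank perturbations and nuclear maps -/

section FiniteRank

variable {k : Type*} [NontriviallyNormedField k]

/-- If `T` is at distance less than one from an operator of finite rank, then the kernel of
`1 - T` is finite dimensional. -/
theorem ContinuousLinearMap.finiteDimensional_ker_one_sub {E : Type*} [NormedAddCommGroup E]
    [NormedSpace k E] (T F : E →L[k] E) [FiniteDimensional k (F : E →ₗ[k] E).range]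
    (h : ‖T - F‖ < 1) :
    FiniteDimensional k (1 - T : E →L[k] E).toLinearMap.ker := by
  -- On this kernel `F` is injective: if T x = x and F x = 0, then x = (T - F) x with ‖T - F‖ < 1.
  refine Module.Finite.of_injective
    ((F : E →ₗ[k] E).rangeRestrict ∘ₗ (1 - T : E →L[k] E).toLinearMap.ker.subtype) ?_
  rw [← LinearMap.ker_eq_bot, LinearMap.ker_eq_bot']
  rintro ⟨x, hx⟩ hFx
  have hFx : F x = 0 := congrArg Subtype.val hFx
  have hx : x - T x = 0 := hx
  have h1 : ‖x‖ ≤ ‖T - F‖ * ‖x‖ := by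
    simpa [hFx, ← sub_eq_zero.1 hx] using (T - F).le_opNorm x
  have : ‖x‖ = 0 := by nlinarith [norm_nonneg x]
  exact Subtype.ext (norm_eq_zero.1 this)

/-- If `T` is at distance less than one from an operator `F` of finite rank on a Banach space, then
the ranges of `1 - T` and `F` span the space. -/
theorem ContinuousLinearMap.exists_eq_sub_add {E : Type*} [NormedAddCommGroup E]
    [NormedSpace k E] [CompleteSpace E] (T F : E →L[k] E) (h : ‖T - F‖ < 1) (y : E) :
    ∃ x, y = (x - T x) + F x := by
  -- Neumann series: 1 - (T - F) = (1 - T) + F is invertible.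
  let u := Units.oneSub (T - F) h
  refine ⟨(u⁻¹).val y, ?_⟩
  have h1 : u.val ((u⁻¹).val y) = y := by
    rw [← mul_apply_eq_comp, u.mul_inv, one_apply_eq_self]
  conv_lhs => rw [← h1]
  generalize (u⁻¹).val y = z
  simp only [u, Units.val_oneSub, sub_apply, one_apply_eq_self]
  abel

/-- A nuclear map is a limit of maps of finite rank. -/
theorem IsNuclearMap.exists_finiteRank {E F : Type*} [NormedAddCommGroup E] [NormedSpace k E]
    [NormedAddCommGroup F] [NormedSpace k F] {f : E →L[k] F} (hf : IsNuclearMap f)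
    (hF : IsUltrametricDist k → IsUltrametricDist F) {ε : ℝ} (hε : 0 < ε) :
    ∃ g : E →L[k] F, FiniteDimensional k (g : E →ₗ[k] F).range ∧ ‖f - g‖ ≤ ε := by
  obtain ⟨l, y, hly, hsum⟩ := hf
  have hterm : ∀ n x, ‖l n x • y n‖ ≤ ‖l n‖ * ‖y n‖ * ‖x‖ := fun n x => by
    rw [norm_smul, mul_right_comm]
    gcongr
    exact (l n).le_opNorm x
  suffices h : ∃ N, ∀ x, ‖f x - ∑ n ∈ Finset.range N, l n x • y n‖ ≤ ε * ‖x‖ by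
    obtain ⟨N, hN⟩ := h
    refine ⟨∑ n ∈ Finset.range N, (l n).smulRight (y n), ?_, ?_⟩
    · have := FiniteDimensional.span_of_finite k ((Finset.range N).finite_toSet.image y)
      refine Submodule.finiteDimensional_of_le
        (S₂ := Submodule.span k (y '' Finset.range N)) ?_
      rintro _ ⟨x, rfl⟩
      simp only [ContinuousLinearMap.coe_coe, sum_apply,
        ContinuousLinearMap.smulRight_apply]
      exact Submodule.sum_mem _ fun n hn =>
        Submodule.smul_mem _ _ (Submodule.subset_span ⟨n, hn, rfl⟩)
    · refine ContinuousLinearMap.opNorm_le_bound _ hε.le fun x => ?_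
      simpa [sum_apply] using hN x
  have htail : ∀ N x, HasSum (fun n => l (n + N) x • y (n + N))
      (f x - ∑ n ∈ Finset.range N, l n x • y n) := fun N x =>
    (hasSum_nat_add_iff' (f := fun n => l n x • y n) N).2 (hsum x)
  rcases hly with hly | ⟨hk, hly⟩
  · obtain ⟨N, hN⟩ := ((tendsto_sum_nat_add fun n => ‖l n‖ * ‖y n‖).eventually_lt_const hε).exists
    refine ⟨N, fun x => ?_⟩
    have hs := ((summable_nat_add_iff N).2 hly).hasSum.mul_right ‖x‖
    refine ((htail N x).norm_le_of_bounded hs fun n => hterm _ x).trans ?_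
    gcongr
  · obtain ⟨N, hN⟩ := Filter.eventually_atTop.1 (hly.eventually_lt_const hε)
    have := hF hk
    refine ⟨N, fun x => ?_⟩
    -- By the strong triangle inequality, a uniform bound on the terms of the tail bounds all its
    -- finite sums.
    refine le_of_tendsto (htail N x).norm (Filter.Eventually.of_forall fun s => ?_)
    refine IsUltrametricDist.norm_sum_le_of_forall_le_of_nonneg (by positivity) fun n _ => ?_
    refine (hterm _ x).trans ?_
    gcongr
    exact (hN (n + N) (by omega)).le

end FiniteRank

/-! ### Local Banach spaces -/

section LocalBanach

variable {k : Type*} [NontriviallyNormedField k] {V : Type*} [AddCommGroup V] [Module k V]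

/-- The inequality extends from the dense image of `V` by continuity. It makes the null-sequence
form of nuclearity usable for finite rank approximation. -/
theorem LocalBanach.isUltrametricDist [IsUltrametricDist k] {p : Seminorm k V}
    (hp : p.IsAdmissible) : IsUltrametricDist (LocalBanach p) := by
  refine IsUltrametricDist.isUltrametricDist_of_forall_norm_add_le_max_norm fun x y => ?_
  induction x, y using UniformSpace.Completion.induction_on₂ with
  | hp => exact isClosed_le (by fun_prop) (by fun_prop)
  | ih x y =>
    rw [← UniformSpace.Completion.coe_add]
    simp only [UniformSpace.Completion.norm_coe]
    exact hp inferInstance x y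

variable [TopologicalSpace V] [IsTopologicalAddGroup V]

/-- The canonical map `(V, p) → V` followed by a linear map `f` is continuous. -/
def SeminormedBy.lift {W : Type*} [AddCommGroup W] [Module k W] [TopologicalSpace W]
    [IsTopologicalAddGroup W] (p : Seminorm k V) (f : V →ₗ[k] W)
    (hf : ∀ U ∈ 𝓝 (0 : W), ∃ ε > 0, ∀ x, p x < ε → f x ∈ U) : SeminormedBy p →L[k] W where
  toFun x := f x
  map_add' := f.map_add
  map_smul' := f.map_smul
  cont := by
    let g : SeminormedBy p →+ W := f.toAddMonoidHom
    refine continuous_of_continuousAt_zero g ?_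
    rw [ContinuousAt, map_zero, Filter.tendsto_def]
    intro U hU
    obtain ⟨ε, hε, h⟩ := hf U hU
    refine Metric.mem_nhds_iff.2 ⟨ε, hε, fun x hx => h x ?_⟩
    simpa [SeminormedBy.norm_def] using hx

/-- For a continuous seminorm `p`, the canonical map from `V` to its local Banach space. -/
def LocalBanach.mk (p : Seminorm k V) (hp : Continuous p) : V →L[k] LocalBanach p where
  toFun x := UniformSpace.Completion.coe' (α := SeminormedBy p) x
  map_add' x y := UniformSpace.Completion.coe_add (α := SeminormedBy p) x y
  map_smul' a x := UniformSpace.Completion.coe_smul (X := SeminormedBy p) a x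
  cont := by
    refine (UniformSpace.Completion.continuous_coe (SeminormedBy p)).comp ?_
    let g : V →+ SeminormedBy p := AddMonoidHom.id V
    refine continuous_of_continuousAt_zero g ?_
    rw [ContinuousAt, map_zero, tendsto_zero_iff_norm_tendsto_zero]
    have h0 := hp.tendsto 0
    rwa [map_zero] at h0

end LocalBanach

/-! ### Riesz theory on nuclear Fréchet spaces -/

section Frechet

variable {k : Type*} [NontriviallyNormedField k] {X : Type*} [AddCommGroup X] [Module k X]
  [TopologicalSpace X]

theorem IsFrechetTVS.baireSpace (h : IsFrechetTVS k X) : BaireSpace X := by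
  have := h.isTopologicalAddGroup
  have := h.metrizable
  let := IsTopologicalAddGroup.rightUniformSpace X
  have := isUniformAddGroup_of_addCommGroup (G := X)
  have := h.complete
  have := IsUniformAddGroup.uniformity_countably_generated (α := X)
  infer_instance

/-- A continuous linear map from a Fréchet space to the strong dual of a first countable space
is bounded on some neighbourhood of zero. -/
theorem IsFrechetTVS.exists_nhds_isVonNBounded_image (hX : IsFrechetTVS k X) {F : Type*}
    [AddCommGroup F] [Module k F] [TopologicalSpace F] [IsTopologicalAddGroup F]
    [ContinuousSMul k F] [FirstCountableTopology F] (c : X →L[k] F →L[k] k) :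
    ∃ U ∈ 𝓝 (0 : X), Bornology.IsVonNBounded k (c '' U) := by
  have := hX.isTopologicalAddGroup
  have := hX.baireSpace
  obtain ⟨W, hW⟩ := (𝓝 (0 : F)).exists_antitone_basis
  -- These closed sets cover `X` because each `c x` is continuous; Baire gives one with nonempty
  -- interior.
  let A : ℕ → Set X := fun n => {x | ∀ f ∈ W n, ‖c x f‖ ≤ 1}
  have hA : ∀ n, IsClosed (A n) := fun n => by
    simp only [A, Set.ofPred_forall]
    refine isClosed_iInter fun f => isClosed_iInter fun _ => ?_
    exact isClosed_le ((continuous_eval_const f).comp c.continuous).norm continuous_const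
  have hAU : ⋃ n, A n = Set.univ := by
    refine Set.eq_univ_of_forall fun x => Set.mem_iUnion.2 ?_
    have : {f | ‖c x f‖ < 1} ∈ 𝓝 (0 : F) :=
      (isOpen_lt (c x).continuous.norm continuous_const).mem_nhds (by simp)
    obtain ⟨n, -, hn⟩ := hW.toHasBasis.mem_iff.1 this
    exact ⟨n, fun f hf => le_of_lt (hn hf)⟩
  obtain ⟨n, x₀, hx₀⟩ := nonempty_interior_of_iUnion_of_closed hA hAU
  have hU : (fun x => x₀ + x) ⁻¹' A n ∈ 𝓝 (0 : X) := by
    refine (continuous_const_add x₀).continuousAt.preimage_mem_nhds ?_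
    simpa using mem_interior_iff_mem_nhds.1 hx₀
  refine ⟨_, hU, ContinuousLinearMap.isVonNBounded_iff.2 fun s hs => ?_⟩
  -- The bounded set `s` lies in `a • W n`. The factor 2 below comes from c x = c (x₀ + x) - c x₀.
  obtain ⟨a, ha⟩ := (hs (hW.mem n)).exists
  rw [NormedSpace.isVonNBounded_iff, isBounded_iff_forall_norm_le]
  refine ⟨‖a‖ * 2, ?_⟩
  rintro _ ⟨_, ⟨x, hx, rfl⟩, f, hf, rfl⟩
  obtain ⟨g, hg, rfl⟩ := ha hf
  have h1 : ‖c (x₀ + x) g‖ ≤ 1 := hx g hg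
  have h2 : ‖c x₀ g‖ ≤ 1 := interior_subset hx₀ g hg
  have h3 : ‖c x g‖ ≤ 2 := by
    have : c x g = c (x₀ + x) g - c x₀ g := by simp
    rw [this]
    exact (norm_sub_le _ _).trans (by linarith)
  simp only [map_smul, norm_smul]
  gcongr

/-- Riesz theory: if `K` is an endomorphism of a nuclear Fréchet space that is bounded on a
neighbourhood of zero, then `1 - K` has finite dimensional kernel and cokernel. -/
theorem IsFNSpace.finiteDimensional_ker_and_coker (hX : IsFNSpace k X) (K : X →L[k] X) {U : Set X}
    (hU : U ∈ 𝓝 0) (hK : Bornology.IsVonNBounded k (K '' U)) :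
    FiniteDimensional k (LinearMap.id - K.toLinearMap).ker ∧
      FiniteDimensional k (X ⧸ (LinearMap.id - K.toLinearMap).range) := by
  have := hX.isTopologicalAddGroup
  have := hX.metrizable
  have := hX.continuousSMul
  let := IsTopologicalAddGroup.rightUniformSpace X
  have := isUniformAddGroup_of_addCommGroup (G := X)
  have := hX.complete
  obtain ⟨p, hp, hpc, hpU⟩ := hX.exists_seminorm U hU
  obtain ⟨q, hq, hqc, hpq, hnuc⟩ := hX.nuclear p hp hpc
  have hbound : ∀ W ∈ 𝓝 (0 : X), ∃ ε > 0, ∀ x, p x < ε → K x ∈ W := fun W hW => by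
    obtain ⟨a, ha, ha0⟩ := ((hK hW).and (Bornology.eventually_ne_cobounded (0 : k))).exists
    have ha' : 0 < ‖a‖ := norm_pos_iff.2 ha0
    refine ⟨‖a‖⁻¹, by positivity, fun x hx => ?_⟩
    have hax : a • x ∈ U := hpU <| by
      rw [Set.mem_ofPred_eq, map_smul_eq_mul, ← mul_inv_cancel₀ ha'.ne']
      gcongr
    have := ha ⟨_, hax, rfl⟩
    rwa [map_smul, Set.smul_mem_smul_set_iff₀ ha0] at this
  let ι : SeminormedBy p →L[k] LocalBanach p := UniformSpace.Completion.toComplL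
  -- By `hbound`, `K` is continuous for `p` alone, so it extends to the completion.
  let J : LocalBanach p →L[k] X := (SeminormedBy.lift p K.toLinearMap hbound).extend ι
  have hJ : ∀ x, J (LocalBanach.mk p hpc x) = K x := fun x =>
    ContinuousLinearMap.extend_eq (SeminormedBy.lift p K.toLinearMap hbound) (e := ι)
      UniformSpace.Completion.denseRange_coe
      (UniformSpace.Completion.isUniformInducing_coe _) x
  let B : LocalBanach p →L[k] LocalBanach q := (LocalBanach.mk q hqc).comp J
  obtain ⟨g, hg, hfg⟩ := hnuc.exists_finiteRank (fun _ => LocalBanach.isUltrametricDist hp)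
    -- Chosen so that ε‖B‖ < 1, including when B = 0.
    (ε := (‖B‖ + 1)⁻¹) (by positivity)
  let T : LocalBanach p →L[k] LocalBanach p := (LocalBanach.mk p hpc).comp J
  have hT : T = (LocalBanach.map hpq).comp B := by
    ext x
    exact (UniformSpace.Completion.map_coe (SeminormedBy.map hpq).uniformContinuous _).symm
  have hTg : ‖T - g.comp B‖ < 1 := by
    rw [hT, ← ContinuousLinearMap.sub_comp]
    calc _ ≤ ‖LocalBanach.map hpq - g‖ * ‖B‖ := ContinuousLinearMap.opNorm_comp_le _ _
      _ ≤ (‖B‖ + 1)⁻¹ * ‖B‖ := by gcongr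
      _ < 1 := by
        rw [inv_mul_lt_iff₀ (by positivity)]
        linarith
  have hgB : FiniteDimensional k (g.comp B).toLinearMap.range :=
    Submodule.finiteDimensional_of_le (LinearMap.range_comp_le_range B.toLinearMap g.toLinearMap)
  constructor
  · have := ContinuousLinearMap.finiteDimensional_ker_one_sub T (g.comp B) hTg
    have hmem : ∀ x ∈ (LinearMap.id - K.toLinearMap).ker,
        LocalBanach.mk p hpc x ∈ (1 - T : LocalBanach p →L[k] LocalBanach p).toLinearMap.ker := by
      intro x hx
      have hx : x - K x = 0 := hx
      change LocalBanach.mk p hpc x - LocalBanach.mk p hpc (J (LocalBanach.mk p hpc x)) = 0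
      rw [hJ, ← map_sub, hx, map_zero]
    refine Module.Finite.of_injective ((LocalBanach.mk p hpc).toLinearMap.restrict hmem) ?_
    rw [← LinearMap.ker_eq_bot, LinearMap.ker_eq_bot']
    rintro ⟨x, hx⟩ h0
    have h0 : LocalBanach.mk p hpc x = 0 := congrArg Subtype.val h0
    have hx : x - K x = 0 := hx
    rw [← hJ, h0, map_zero, sub_zero] at hx
    exact Subtype.ext hx
  · have : FiniteDimensional k (J.toLinearMap ∘ₗ (g.comp B).toLinearMap).range := by
      rw [LinearMap.range_comp]
      infer_instance
    refine LinearMap.finiteDimensional_quotient_range_of_le _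
      (J.toLinearMap ∘ₗ (g.comp B).toLinearMap) fun y => ?_
    obtain ⟨x, hx⟩ := T.exists_eq_sub_add (g.comp B) hTg (LocalBanach.mk p hpc y)
    -- Applying `J` to `hx` gives K y = J x - K (J x) + J (g (B x)); solving for y produces this
    -- witness.
    refine ⟨y + J x, x, ?_⟩
    have hy := congrArg J hx
    have hTx : J (T x) = K (J x) := hJ _
    rw [hJ, map_add, map_sub, hTx] at hy
    change y = (y + J x) - K (y + J x) + J (g.comp B x)
    rw [map_add, hy]
    abel

/-- If an endomorphism of an (FN)-space factors through a (DFN)-space, then its difference with the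
identity has finite dimensional kernel and cokernel. -/
theorem IsFNSpace.finiteDimensional_ker_and_coker_of_factors (hX : IsFNSpace k X) {Y : Type*}
    [AddCommGroup Y] [Module k Y] [TopologicalSpace Y] (hY : IsDFNSpace k Y)
    (c : X →L[k] Y) (b : Y →L[k] X) :
    FiniteDimensional k (LinearMap.id - (b.comp c).toLinearMap).ker ∧
      FiniteDimensional k (X ⧸ (LinearMap.id - (b.comp c).toLinearMap).range) := by
  obtain ⟨F, _, _, _, hF, ⟨e⟩⟩ := hY
  have := hF.isTopologicalAddGroup
  have := hF.continuousSMul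
  have := hF.metrizable
  -- Supplies the countable neighbourhood base of the predual used in the Baire argument.
  let := TopologicalSpace.metrizableSpaceMetric F
  obtain ⟨U, hU, hc⟩ :=
    hX.toIsFrechetTVS.exists_nhds_isVonNBounded_image (e.toContinuousLinearMap.comp c)
  have hb := hc.image (b.comp e.symm.toContinuousLinearMap)
  refine hX.finiteDimensional_ker_and_coker (b.comp c) hU ?_
  rw [Set.image_image] at hb
  simp only [ContinuousLinearMap.comp_apply, ContinuousLinearEquiv.coe_coe,
    ContinuousLinearEquiv.symm_apply_apply] at hb
  exact hb

end Frechet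

/-! ### Comparison of two decompositions -/

theorem mainTheorem6 {k : Type*} [NontriviallyNormedField k] [IsLocalFieldCharZero k]
    {V : Type*} [AddCommGroup V] [Module k V] [TopologicalSpace V]
    (hV : IsAnalyticTateSpace k V) (L G : Submodule k V)
    (hL : IsFNLattice L) (hG : IsDFNLattice G) :
    FiniteDimensional k (L ⊓ G : Submodule k V) ∧ FiniteDimensional k (V ⧸ (L ⊔ G)) := by
  have := hV.1.isTopologicalAddGroup
  obtain ⟨hLfn, G', hG', hLG'⟩ := hL
  obtain ⟨hGdfn, L', hL', hLG⟩ := hG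
  have hsum : ∀ v : V, (L'.projectionOntoL G hLG v : V) + G.projectionOntoL L' hLG.symm v = v :=
    fun v => by simpa using DFunLike.congr_fun (Submodule.projectionL_add_projectionL_eq_id hLG) v
  have hsum' : ∀ v : V, (L.projectionOntoL G' hLG' v : V) + G'.projectionOntoL L hLG'.symm v = v :=
    fun v => by simpa using DFunLike.congr_fun (Submodule.projectionL_add_projectionL_eq_id hLG') v
  constructor
  · obtain ⟨h, -⟩ := hLfn.finiteDimensional_ker_and_coker_of_factors hGdfn
      ((G.projectionOntoL L' hLG.symm).comp L.subtypeL)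
      ((L.projectionOntoL G' hLG').comp G.subtypeL)
    have hmem : ∀ x : V, ∀ hx : x ∈ L ⊓ G, (⟨x, hx.1⟩ : L) ∈ (LinearMap.id -
        (((L.projectionOntoL G' hLG').comp G.subtypeL).comp
          ((G.projectionOntoL L' hLG.symm).comp L.subtypeL)).toLinearMap).ker := by
      intro x hx
      have h1 : G.projectionOntoL L' hLG.symm x = ⟨x, hx.2⟩ :=
        Submodule.projectionOntoL_apply_left hLG.symm ⟨x, hx.2⟩
      have h2 : L.projectionOntoL G' hLG' x = ⟨x, hx.1⟩ :=
        Submodule.projectionOntoL_apply_left hLG' ⟨x, hx.1⟩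
      change (⟨x, hx.1⟩ : L) - L.projectionOntoL G' hLG' (G.projectionOntoL L' hLG.symm x) = 0
      rw [h1, h2, sub_self]
    refine Module.Finite.of_injective
      ((Submodule.inclusion (inf_le_left : L ⊓ G ≤ L)).codRestrict _ fun x => hmem x x.2) ?_
    intro x y hxy
    exact Subtype.ext (congrArg (fun z => ((z : L) : V)) (congrArg Subtype.val hxy))
  · obtain ⟨-, h⟩ := hL'.finiteDimensional_ker_and_coker_of_factors hG'
      ((G'.projectionOntoL L hLG'.symm).comp L'.subtypeL)
      ((L'.projectionOntoL G hLG).comp G'.subtypeL)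
    have hle : (LinearMap.id - (((L'.projectionOntoL G hLG).comp G'.subtypeL).comp
        ((G'.projectionOntoL L hLG'.symm).comp L'.subtypeL)).toLinearMap).range ≤
          (L ⊔ G).comap L'.subtype := by
      rintro _ ⟨x, rfl⟩
      have h1 := hsum' x
      have h2 := hsum (G'.projectionOntoL L hLG'.symm x)
      -- Split x along L ⊕ G', then split its G'-component along L' ⊕ G.
      have : (x : V) - L'.projectionOntoL G hLG (G'.projectionOntoL L hLG'.symm x) =
          L.projectionOntoL G' hLG' x +
            G.projectionOntoL L' hLG.symm (G'.projectionOntoL L hLG'.symm x) := by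
        rw [← sub_eq_iff_eq_add'.2 h2.symm, ← add_sub_assoc, h1]
      change (x : V) - L'.projectionOntoL G hLG (G'.projectionOntoL L hLG'.symm x) ∈ L ⊔ G
      rw [this]
      exact Submodule.add_mem_sup (Subtype.coe_prop _) (Subtype.coe_prop _)
    refine Module.Finite.of_surjective (Submodule.mapQ _ (L ⊔ G) L'.subtype hle) fun z => ?_
    obtain ⟨v, rfl⟩ := (L ⊔ G).mkQ_surjective z
    refine ⟨Submodule.Quotient.mk (L'.projectionOntoL G hLG v), ?_⟩
    rw [Submodule.mapQ_apply, Submodule.mkQ_apply, eq_comm, Submodule.Quotient.eq]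
    nth_rw 1 [← hsum v]
    rw [Submodule.subtype_apply, add_sub_cancel_left]
    exact Submodule.mem_sup_right (Subtype.coe_prop _)
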